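/- Let $n\ge 3$, let $\alpha>n-2$, and let $\mu$ be a finite (real) signed Borel measure on $\mathbb R^n$ with compact support which is $\alpha$-dimensional, i.e. there is a constant $C_\mu$ such that $$|\mu|(B(x,r))\le C_\mu r^{\alpha}\qquad\text{for all } x\in\mathbb R^n \text{ and all } r>0 .$$ Let $-\Delta+\mu$ denote the self-adjoint operator on $L^2(\mathbb R^n;\mathbb C)$ associated with the closed quadratic form $$q(u,v)=\int_{\mathbb R^n}\nabla u\cdot\overline{\nabla v}\,dx+\int_{\mathbb R^n}u\,\overline v\,d\mu ,\qquad u,v\in H^1(\mathbb R^n),$$ where elements of $H^1(\mathbb R^n)$ are regarded as elements of $L^2(|\mu|)$ through the continuous extension of the inclusion $C_c^\infty(\mathbb R^n)\subset L^2(|\mu|)$; that is, $u$ lies in the domain and $(-\Delta+\mu)u=f\in L^2(\mathbb R^n)$ if and only if $u\in H^1(\mathbb R^n)$ and $q(u,v)=\int f\,\overline v\,dx$ for all $v\in H^1(\mathbb R^n)$. Then $-\Delta+\mu$ has only finitely many negative eigenvalues, each of finite multiplicity, and it has no other spectrum in $(-\infty,0)$: every $E<0$ that belongs to the spectrum of $-\Delta+\mu$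 is one of these eigenvalues. -/

import Mathlib

open MeasureTheory
open scoped ENNReal ContDiff ComplexConjugate

noncomputable section

namespace MeasureSchrodinger

section Spectrum

variable {F : Type*} [NormedAddCommGroup F] [InnerProductSpace ℂ F]

/-- The eigenspace `{u ∈ D(T) | T u = z u}` of an unbounded operator `T`. -/
def eigenspace (T : F →ₗ.[ℂ] F) (z : ℂ) : Submodule ℂ F :=
  (LinearMap.ker (T.toFun - z • T.domain.subtype)).map T.domain.subtype

/-- `z` is an eigenvalue of `T`: there is a nonzero `u ∈ D(T)` with `T u = z u`. -/
def IsEigenvalue (T : F →ₗ.[ℂ] F) (z : ℂ) : Prop :=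
  ∃ u : T.domain, (u : F) ≠ 0 ∧ T u = z • (u : F)

/-- The resolvent set of an unbounded operator `T`: those `z` for which `T - z : D(T) → F` is a
bijection whose inverse `R` is bounded. -/
def resolventSet (T : F →ₗ.[ℂ] F) : Set ℂ :=
  {z | ∃ R : F →L[ℂ] F,
    (∀ f : F, ∃ h : R f ∈ T.domain, T ⟨R f, h⟩ - z • R f = f) ∧
    ∀ u : T.domain, R (T u - z • (u : F)) = u}

/-- The spectrum of an unbounded operator. -/
def spectrum (T : F →ₗ.[ℂ] F) : Set ℂ := (resolventSet T)ᶜ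

end Spectrum

/-- The signed measure `μ` has compact support: `|μ|` vanishes off some compact set. -/
def CompactlySupported {n : ℕ} (μ : SignedMeasure (EuclideanSpace ℝ (Fin n))) : Prop :=
  ∃ K : Set (EuclideanSpace ℝ (Fin n)), IsCompact K ∧ μ.totalVariation Kᶜ = 0

/-- The signed measure `μ` is `α`-dimensional: `|μ|(B(x,r)) ≤ C r ^ α` for all `x` and `r > 0`. -/
def IsDimensional {n : ℕ} (α : ℝ) (μ : SignedMeasure (EuclideanSpace ℝ (Fin n))) : Prop :=
  ∃ C : ℝ, ∀ (x : EuclideanSpace ℝ (Fin n)) (r : ℝ), 0 < r →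
    μ.totalVariation (Metric.ball x r) ≤ ENNReal.ofReal (C * r ^ α)

/-- The complex Hilbert space `L²(ℝⁿ)`. -/
abbrev L2 (n : ℕ) : Type := Lp ℂ 2 (volume : Measure (EuclideanSpace ℝ (Fin n)))

/-- The space `L²(ℝⁿ) × L²(ℝⁿ)ⁿ × L²(|μ|)`, for triples (function, gradient, values
`|μ|`-almost everywhere). -/
abbrev Triple {n : ℕ} (μ : SignedMeasure (EuclideanSpace ℝ (Fin n))) : Type :=
  L2 n × (Fin n → L2 n) × Lp ℂ 2 μ.totalVariation

/-- The triples `(φ, ∇φ, φ)` with `φ` a complex-valued test function in `C_c^∞(ℝⁿ)`. -/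
def testTriples {n : ℕ} (μ : SignedMeasure (EuclideanSpace ℝ (Fin n))) :
    Submodule ℂ (Triple μ) where
  carrier := {w | ∃ φ : EuclideanSpace ℝ (Fin n) → ℂ, ContDiff ℝ ∞ φ ∧ HasCompactSupport φ ∧
    w.1 =ᵐ[volume] φ ∧
    (∀ i, w.2.1 i =ᵐ[volume] fun x => fderiv ℝ φ x (EuclideanSpace.single i 1)) ∧
    w.2.2 =ᵐ[μ.totalVariation] φ}
  zero_mem' := by
    refine ⟨0, contDiff_const, HasCompactSupport.zero, Lp.coeFn_zero _ _ _, fun i => ?_,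
      Lp.coeFn_zero _ _ _⟩
    filter_upwards [Lp.coeFn_zero ℂ 2 (volume : Measure (EuclideanSpace ℝ (Fin n)))] with x hx
    simp
  add_mem' := by
    rintro v w ⟨φ, hφ, hφc, h1, h2, h3⟩ ⟨ψ, hψ, hψc, k1, k2, k3⟩
    refine ⟨φ + ψ, hφ.add hψ, hφc.add hψc, (Lp.coeFn_add _ _).trans (h1.add k1), fun i => ?_,
      (Lp.coeFn_add _ _).trans (h3.add k3)⟩
    filter_upwards [Lp.coeFn_add (v.2.1 i) (w.2.1 i), h2 i, k2 i] with x hx hx2 hx3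
    rw [fderiv_add (hφ.differentiable (by simp) x) (hψ.differentiable (by simp) x)]
    simpa [hx2, hx3] using hx
  smul_mem' := by
    rintro c w ⟨φ, hφ, hφc, h1, h2, h3⟩
    refine ⟨c • φ, hφ.const_smul c, hφc.smul_left (f := fun _ => c),
      (Lp.coeFn_smul _ _).trans (h1.const_smul c), fun i => ?_,
      (Lp.coeFn_smul _ _).trans (h3.const_smul c)⟩
    filter_upwards [Lp.coeFn_smul c (w.2.1 i), h2 i] with x hx hx2
    rw [fderiv_const_smul (hφ.differentiable (by simp) x)]
    simpa [hx2] using hx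

/-- The form domain `H¹(ℝⁿ)`, whose elements are carried together with their weak gradient and
with their values in `L²(|μ|)`: the closure of the triples `(φ, ∇φ, φ)`, `φ ∈ C_c^∞(ℝⁿ)`. When
`C_c^∞(ℝⁿ) → L²(|μ|)` is bounded for the `H¹` norm this is the set of all `(u, ∇u, j u)`, where
`u ∈ H¹(ℝⁿ)` and `j : H¹(ℝⁿ) → L²(|μ|)` is the inclusion, the continuous extension of
`φ ↦ φ`. -/
def formDomain {n : ℕ} (μ : SignedMeasure (EuclideanSpace ℝ (Fin n))) :
    Submodule ℂ (Triple μ) :=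
  (testTriples μ).topologicalClosure

/-- The sesquilinear form `∫ ∇u · conj ∇v dx + ∫ u conj v dμ` of `-Δ + μ`; the integral against
the signed measure `μ` is the difference of those against its positive and negative parts. -/
def form {n : ℕ} (μ : SignedMeasure (EuclideanSpace ℝ (Fin n))) (u v : Triple μ) : ℂ :=
  ∑ i, inner ℂ (v.2.1 i) (u.2.1 i) +
    ((∫ x, u.2.2 x * conj (v.2.2 x) ∂μ.toJordanDecomposition.posPart) -
      ∫ x, u.2.2 x * conj (v.2.2 x) ∂μ.toJordanDecomposition.negPart)

theorem posPart_le {n : ℕ} (μ : SignedMeasure (EuclideanSpace ℝ (Fin n))) :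
    μ.toJordanDecomposition.posPart ≤ μ.totalVariation :=
  Measure.le_add_right le_rfl

theorem negPart_le {n : ℕ} (μ : SignedMeasure (EuclideanSpace ℝ (Fin n))) :
    μ.toJordanDecomposition.negPart ≤ μ.totalVariation :=
  Measure.le_add_left le_rfl

theorem integrable_mul_conj {n : ℕ} (μ : SignedMeasure (EuclideanSpace ℝ (Fin n)))
    (f g : Lp ℂ 2 μ.totalVariation) :
    Integrable (fun x => f x * conj (g x)) μ.totalVariation := by
  simpa [RCLike.inner_apply] using L2.integrable_inner (𝕜 := ℂ) g f

theorem form_add_left {n : ℕ} (μ : SignedMeasure (EuclideanSpace ℝ (Fin n)))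
    (u u' v : Triple μ) : form μ (u + u') v = form μ u v + form μ u' v := by
  have key : ∀ ν : Measure (EuclideanSpace ℝ (Fin n)), ν ≤ μ.totalVariation →
      ∫ x, (u + u').2.2 x * conj (v.2.2 x) ∂ν =
        ∫ x, u.2.2 x * conj (v.2.2 x) ∂ν + ∫ x, u'.2.2 x * conj (v.2.2 x) ∂ν := by
    intro ν hν
    rw [← integral_add ((integrable_mul_conj μ _ _).mono_measure hν)
      ((integrable_mul_conj μ _ _).mono_measure hν)]
    refine integral_congr_ae ?_
    filter_upwards [ae_mono hν (Lp.coeFn_add u.2.2 u'.2.2)] with x hx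
    rw [Prod.snd_add, Prod.snd_add, hx, Pi.add_apply, add_mul]
  simp only [form, key _ (posPart_le μ), key _ (negPart_le μ)]
  simp only [Prod.snd_add, Prod.fst_add, Pi.add_apply, inner_add_right, Finset.sum_add_distrib]
  ring

theorem form_smul_left {n : ℕ} (μ : SignedMeasure (EuclideanSpace ℝ (Fin n)))
    (c : ℂ) (u v : Triple μ) : form μ (c • u) v = c * form μ u v := by
  have key : ∀ ν : Measure (EuclideanSpace ℝ (Fin n)), ν ≤ μ.totalVariation →
      ∫ x, (c • u).2.2 x * conj (v.2.2 x) ∂ν = c * ∫ x, u.2.2 x * conj (v.2.2 x) ∂ν := by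
    intro ν hν
    rw [← integral_const_mul]
    refine integral_congr_ae ?_
    filter_upwards [ae_mono hν (Lp.coeFn_smul c u.2.2)] with x hx
    simp [hx, mul_assoc]
  simp only [form, key _ (posPart_le μ), key _ (negPart_le μ)]
  simp only [Prod.smul_snd, Prod.smul_fst, Pi.smul_apply, inner_smul_right, ← Finset.mul_sum]
  ring

/-- The graph of the operator associated with the form: `(u, f)` with `u` in the form domain,
`f ∈ L²(ℝⁿ)`, and `∫ ∇u · conj ∇v dx + ∫ u conj v dμ = ∫ f conj v dx` for all `v` in the form
domain. -/
def operatorGraph {n : ℕ} (μ : SignedMeasure (EuclideanSpace ℝ (Fin n))) :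
    Submodule ℂ (L2 n × L2 n) where
  carrier := {p | ∃ u ∈ formDomain μ, u.1 = p.1 ∧
    ∀ v ∈ formDomain μ, form μ u v = inner ℂ v.1 p.2}
  zero_mem' := by
    refine ⟨0, zero_mem _, rfl, fun v _ => ?_⟩
    simpa using form_smul_left μ 0 0 v
  add_mem' := by
    rintro p q ⟨u, hu, hup, h⟩ ⟨w, hw, hwq, k⟩
    refine ⟨u + w, add_mem hu hw, by simp [hup, hwq], fun v hv => ?_⟩
    rw [form_add_left, h v hv, k v hv, Prod.snd_add, inner_add_right]
  smul_mem' := by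
    rintro c p ⟨u, hu, hup, h⟩
    refine ⟨c • u, Submodule.smul_mem _ c hu, by simp [hup], fun v hv => ?_⟩
    rw [form_smul_left, h v hv, Prod.smul_snd, inner_smul_right]

/-- The Schrödinger operator `-Δ + μ` on `L²(ℝⁿ)`, the self-adjoint operator associated with the
closed form `∫ ∇u · conj ∇v dx + ∫ u conj v dμ` on `H¹(ℝⁿ)`. -/
def schrodinger {n : ℕ} (μ : SignedMeasure (EuclideanSpace ℝ (Fin n))) : L2 n →ₗ.[ℂ] L2 n :=
  (operatorGraph μ).toLinearPMap

end MeasureSchrodinger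

end

/-! Everything rests on one trace inequality: for every ε > 0 there are finitely many vectors e_c in
L²(ℝⁿ) such that ‖u‖²_{L²(|μ|)} ≤ ε ‖∇u‖² + ∑ |⟨e_c, u⟩|² on the form domain
(`exists_finset_sq_norm_le`). It comes from covering the support by finitely many balls of a small
radius r: on each ball u is close to its mean, with an error in L²(|μ|) of order r^(α-(n-2)) ‖∇u‖²,
and the means are the functionals.

With ε = 1 the form is nonnegative on the common kernel of the functionals. A space on which the
form is negative definite therefore injects into ℂ^s, s being the finite set of centres. This bounds
the multiplicity of each negative eigenvalue, and, since eigenvectors of distinct eigenvalues are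
orthogonal, the number of these eigenvalues.

With ε = 1/4 and E < 0 the shifted form q - E is coercive on the form domain up to a finite-rank
term. By Lax–Milgram and the Fredholm alternative (`isUnit_of_injective_of_coercive_add_sum`) the
operator A representing it is invertible as soon as it is injective, that is, unless E is an
eigenvalue. If J is the inclusion into L², then J A⁻¹ J* is the bounded resolvent at E. -/

noncomputable section

namespace MeasureSchrodinger

/-! ### The trace inequality for α-dimensional measures. -/

section TraceInequality

variable {E : Type*} [NormedAddCommGroup E] [NormedSpace ℝ E]

theorem enorm_sub_le_lintegral_fderiv {F : Type*} [NormedAddCommGroup F] [NormedSpace ℝ F]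
    [CompleteSpace F] {φ : E → F} (hφ : ContDiff ℝ 1 φ) (x y : E) :
    ‖φ x - φ y‖ₑ ≤ (∫⁻ t in Set.Ioo (0 : ℝ) 1, ‖fderiv ℝ φ (x + t • (y - x))‖ₑ) * ‖y - x‖ₑ := by
  have hder : ∀ t : ℝ, HasDerivAt (fun t : ℝ => φ (x + t • (y - x)))
      (fderiv ℝ φ (x + t • (y - x)) (y - x)) t := by
    intro t
    have h1 : HasDerivAt (fun t : ℝ => x + t • (y - x)) (y - x) t := by
      simpa using ((hasDerivAt_id t).smul_const (y - x)).const_add x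
    exact ((hφ.differentiable (by simp) _).hasFDerivAt).comp_hasDerivAt t h1
  have hc : Continuous fun t : ℝ => fderiv ℝ φ (x + t • (y - x)) :=
    (hφ.continuous_fderiv (by simp)).comp (by fun_prop)
  have h2 := intervalIntegral.integral_eq_sub_of_hasDerivAt (a := 0) (b := 1)
    (fun t _ => hder t) ((hc.clm_apply continuous_const).intervalIntegrable 0 1)
  simp only [one_smul, zero_smul, add_zero, add_sub_cancel] at h2
  rw [enorm_sub_rev, ← h2, intervalIntegral.integral_of_le zero_le_one, integral_Ioc_eq_integral_Ioo]
  refine (enorm_integral_le_lintegral_enorm _).trans ?_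
  rw [← lintegral_mul_const _ (by exact hc.enorm.measurable)]
  exact lintegral_mono fun t => ContinuousLinearMap.le_opENorm _ _

/-- Cauchy–Schwarz applied to f = √w · (√v f). -/
theorem sq_lintegral_le_of_mul_eq_one {X : Type*} [MeasurableSpace X] {m : Measure X}
    {f w v : X → ℝ≥0∞} (hf : Measurable f) (hw : Measurable w) (hv : Measurable v)
    (h : ∀ᵐ x ∂m, w x * v x = 1) :
    (∫⁻ x, f x ∂m) ^ 2 ≤ (∫⁻ x, w x ∂m) * ∫⁻ x, v x * f x ^ 2 ∂m := by
  have hsq : ∀ a : ℝ≥0∞, (a ^ (1 / 2 : ℝ)) ^ (2 : ℕ) = a := fun a => by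
    rw [← ENNReal.rpow_natCast, ← ENNReal.rpow_mul]; norm_num
  have key := ENNReal.lintegral_mul_le_Lp_mul_Lq m Real.HolderConjugate.two_two
    (f := fun x => w x ^ (1 / 2 : ℝ)) (g := fun x => v x ^ (1 / 2 : ℝ) * f x)
    (hw.pow_const _).aemeasurable ((hv.pow_const _).mul hf).aemeasurable
  have e1 : ∫⁻ x, f x ∂m = ∫⁻ x, ((fun x => w x ^ (1 / 2 : ℝ)) *
      fun x => v x ^ (1 / 2 : ℝ) * f x) x ∂m := by
    refine lintegral_congr_ae ?_
    filter_upwards [h] with x hx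
    rw [Pi.mul_apply, ← mul_assoc, ← ENNReal.mul_rpow_of_nonneg _ _ (by norm_num), hx,
      ENNReal.one_rpow, one_mul]
  rw [e1]
  refine (pow_le_pow_left' key 2).trans_eq ?_
  rw [mul_pow, hsq, hsq]
  congr 1
  · exact lintegral_congr fun x => by rw [ENNReal.rpow_two, hsq]
  · exact lintegral_congr fun x => by rw [ENNReal.rpow_two, mul_pow, hsq]

variable [MeasurableSpace E] [BorelSpace E] [FiniteDimensional ℝ E]

theorem lintegral_comp_homothety (ν : Measure E) [ν.IsAddHaarMeasure] {H : E → ℝ≥0∞}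
    (hH : Measurable H) (x : E) {t : ℝ} (ht : 0 < t) :
    ∫⁻ y, H (x + t • (y - x)) ∂ν =
      ENNReal.ofReal ((t ^ Module.finrank ℝ E)⁻¹) * ∫⁻ y, H y ∂ν := by
  rw [lintegral_sub_right_eq_self (fun y => H (x + t • y)) x]
  have h := Measure.map_addHaar_smul ν ht.ne'
  rw [abs_of_pos (by positivity)] at h
  have hm : Measurable fun y : E => t • y := measurable_const_smul t
  rw [← lintegral_map (f := fun y => H (x + y)) (hH.comp (measurable_const_add x)) hm, h,
    lintegral_smul_measure, lintegral_add_left_eq_self, smul_eq_mul]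

theorem lintegral_rpow_sub_one {η : ℝ} (hη : 0 < η) :
    ∫⁻ t in Set.Ioo (0 : ℝ) 1, ENNReal.ofReal (t ^ (η - 1)) = ENNReal.ofReal η⁻¹ := by
  have hi := (intervalIntegral.intervalIntegrable_rpow' (a := 0) (b := 1) (r := η - 1)
    (by linarith)).1
  rw [← ofReal_integral_eq_lintegral_ofReal (hi.mono_set Set.Ioo_subset_Ioc_self),
    ← integral_Ioc_eq_integral_Ioo, ← intervalIntegral.integral_of_le zero_le_one,
    integral_rpow (Or.inl (by linarith))]
  · simp [Real.zero_rpow hη.ne']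
  · filter_upwards [ae_restrict_mem measurableSet_Ioo] with t ht
    exact Real.rpow_nonneg ht.1.le _

/-- Average the fundamental theorem of calculus along the segments from x to the points y of the
ball, apply Cauchy–Schwarz in (y, t), then substitute z = x + t(y - x) for fixed t. The substitution
has Jacobian t^(-d) and moves the ball into the ball of radius 2tr about x. The free parameter η is
tuned later to the dimension of the measure. -/
theorem measure_ball_mul_sq_enorm_sub_average_le (ν : Measure E) [ν.IsAddHaarMeasure]
    {F : Type*} [NormedAddCommGroup F] [NormedSpace ℝ F] [CompleteSpace F]
    {φ : E → F} (hφ : ContDiff ℝ 1 φ)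
    {x c : E} {r : ℝ} (hx : dist x c < r) {η : ℝ} (hη : 0 < η) :
    ν (Metric.ball c r) * ‖φ x - ⨍ y in Metric.ball c r, φ y ∂ν‖ₑ ^ 2 ≤
      ENNReal.ofReal (2 * r) ^ 2 * ENNReal.ofReal η⁻¹ * ∫⁻ t in Set.Ioo (0 : ℝ) 1,
        ENNReal.ofReal (t ^ (1 - η - Module.finrank ℝ E)) *
          ∫⁻ z in Metric.ball x (2 * t * r), ‖fderiv ℝ φ z‖ₑ ^ 2 ∂ν := by
  have hr : 0 < r := dist_nonneg.trans_lt hx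
  set B := Metric.ball c r with hB
  have hb0 : ν B ≠ 0 := (Metric.measure_ball_pos ν c hr).ne'
  have hbt : ν B ≠ ⊤ := measure_ball_lt_top.ne
  set g : E → ℝ≥0∞ := fun z => ‖fderiv ℝ φ z‖ₑ with hg
  have hgc : Continuous g := (hφ.continuous_fderiv (by simp)).enorm
  have hint : IntegrableOn φ B ν :=
    (hφ.continuous.locallyIntegrable.integrableOn_isCompact
      (isCompact_closedBall c r)).mono_set Metric.ball_subset_closedBall
  have hav : φ x - ⨍ y in B, φ y ∂ν = ⨍ y in B, (φ x - φ y) ∂ν := by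
    rw [setAverage_eq, setAverage_eq, integral_sub (integrable_const_iff.2 (Or.inr
      ⟨by simpa using hbt.lt_top⟩)) hint, setIntegral_const, smul_sub, smul_smul,
      inv_mul_cancel₀, one_smul]
    exact (ENNReal.toReal_pos hb0 hbt).ne'
  have h1 : ν B * ‖φ x - ⨍ y in B, φ y ∂ν‖ₑ ≤
      ENNReal.ofReal (2 * r) * ∫⁻ y in B, (∫⁻ t in Set.Ioo (0 : ℝ) 1, g (x + t • (y - x))) ∂ν := by
    rw [hav, setAverage_eq, enorm_smul, Measure.real, enorm_inv
      (ENNReal.toReal_pos hb0 hbt).ne', Real.enorm_of_nonneg ENNReal.toReal_nonneg,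
      ENNReal.ofReal_toReal hbt, ← mul_assoc, ENNReal.mul_inv_cancel hb0 hbt, one_mul]
    refine (enorm_integral_le_lintegral_enorm _).trans ?_
    rw [← lintegral_const_mul' _ _ ENNReal.ofReal_ne_top]
    refine setLIntegral_mono' measurableSet_ball fun y hy => ?_
    refine (enorm_sub_le_lintegral_fderiv hφ x y).trans ?_
    rw [mul_comm]
    gcongr
    rw [← ofReal_norm]
    gcongr
    rw [← dist_eq_norm]
    have := dist_triangle_right y x c
    rw [hB, Metric.mem_ball] at hy
    linarith
  set S := (ν.restrict B).prod ((volume : Measure ℝ).restrict (Set.Ioo 0 1)) with hS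
  have hcp : Continuous fun p : E × ℝ => g (x + p.2 • (p.1 - x)) := hgc.comp (by fun_prop)
  have hwm : ∀ s : ℝ, Measurable fun t : ℝ => ENNReal.ofReal (t ^ s) := fun s =>
    (measurable_id.pow_const s).ennreal_ofReal
  have h2 : (∫⁻ y in B, (∫⁻ t in Set.Ioo (0 : ℝ) 1, g (x + t • (y - x))) ∂ν) ^ 2 ≤
      (ν B * ENNReal.ofReal η⁻¹) * ∫⁻ t in Set.Ioo (0 : ℝ) 1, ENNReal.ofReal (t ^ (1 - η)) *
        ∫⁻ y in B, g (x + t • (y - x)) ^ 2 ∂ν := by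
    rw [← lintegral_prod (μ := ν.restrict B) (ν := volume.restrict (Set.Ioo (0:ℝ) 1))
      (fun p : E × ℝ => g (x + p.2 • (p.1 - x))) hcp.measurable.aemeasurable]
    -- The weight t^(η-1) has integral 1/η on (0,1). Without a weight the power of t left in the end
    -- would be t^(α-d), which need not be integrable, as only α - d > -2 is known.
    refine (sq_lintegral_le_of_mul_eq_one (m := S)
      (w := fun p => ENNReal.ofReal (p.2 ^ (η - 1)))
      (v := fun p => ENNReal.ofReal (p.2 ^ (1 - η))) hcp.measurable
      ((hwm _).comp measurable_snd) ((hwm _).comp measurable_snd) ?_).trans ?_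
    · rw [hS, Measure.prod_restrict]
      filter_upwards [ae_restrict_mem (measurableSet_ball.prod measurableSet_Ioo)] with p hp
      have hp2 : 0 < p.2 := hp.2.1
      rw [← ENNReal.ofReal_mul (by positivity), ← Real.rpow_add hp2]
      simp
    · refine mul_le_mul' (le_of_eq ?_) (le_of_eq ?_)
      · rw [hS, lintegral_prod (fun p : E × ℝ => ENNReal.ofReal (p.2 ^ (η - 1)))
          ((hwm _).comp measurable_snd).aemeasurable]
        simp only [lintegral_rpow_sub_one hη, lintegral_const, Measure.restrict_apply_univ]
        rw [mul_comm]
      · rw [hS, lintegral_prod_symm' (fun p : E × ℝ => ENNReal.ofReal (p.2 ^ (1 - η)) *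
          g (x + p.2 • (p.1 - x)) ^ 2)
          (((hwm _).comp measurable_snd).mul (hcp.measurable.pow_const 2))]
        refine lintegral_congr fun t => ?_
        exact lintegral_const_mul' (ENNReal.ofReal (t ^ (1 - η))) (fun y => g (x + t • (y - x)) ^ 2)
          ENNReal.ofReal_ne_top
  have h3 : ∫⁻ t in Set.Ioo (0 : ℝ) 1, ENNReal.ofReal (t ^ (1 - η)) *
        ∫⁻ y in B, g (x + t • (y - x)) ^ 2 ∂ν ≤ ∫⁻ t in Set.Ioo (0 : ℝ) 1,
        ENNReal.ofReal (t ^ (1 - η - Module.finrank ℝ E)) *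
          ∫⁻ z in Metric.ball x (2 * t * r), g z ^ 2 ∂ν := by
    refine setLIntegral_mono' measurableSet_Ioo fun t ht => ?_
    have ht0 : 0 < t := ht.1
    rw [Real.rpow_sub ht0 (1 - η), div_eq_mul_inv, ENNReal.ofReal_mul (by positivity), mul_assoc,
      Real.rpow_natCast, ← lintegral_indicator measurableSet_ball,
      ← lintegral_indicator measurableSet_ball,
      ← lintegral_comp_homothety ν ((hgc.measurable.pow_const 2).indicator measurableSet_ball) x ht0]
    gcongr with y
    by_cases hy : y ∈ B
    · rw [Set.indicator_of_mem hy, Set.indicator_of_mem]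
      rw [hB, Metric.mem_ball] at hy
      rw [Metric.mem_ball, dist_eq_norm, add_sub_cancel_left, norm_smul, Real.norm_of_nonneg ht0.le,
        ← dist_eq_norm]
      have := dist_triangle_right y x c
      nlinarith
    · rw [Set.indicator_of_notMem hy]
      exact zero_le
  -- Squaring `h1` produces (ν B)² on the left, and the integral of the weight over the ball
  -- produces one factor ν B on the right, which cancels.
  have h4 : ν B * (ν B * ‖φ x - ⨍ y in B, φ y ∂ν‖ₑ ^ 2) ≤ ν B * (ENNReal.ofReal (2 * r) ^ 2 *
      ENNReal.ofReal η⁻¹ * ∫⁻ t in Set.Ioo (0 : ℝ) 1,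
        ENNReal.ofReal (t ^ (1 - η - Module.finrank ℝ E)) *
          ∫⁻ z in Metric.ball x (2 * t * r), g z ^ 2 ∂ν) := by
    calc ν B * (ν B * ‖φ x - ⨍ y in B, φ y ∂ν‖ₑ ^ 2)
        = (ν B * ‖φ x - ⨍ y in B, φ y ∂ν‖ₑ) ^ 2 := by ring
      _ ≤ ENNReal.ofReal (2 * r) ^ 2 * ((ν B * ENNReal.ofReal η⁻¹) * _) := by
        refine (pow_le_pow_left' h1 2).trans ?_
        rw [mul_pow]
        exact mul_le_mul_right (h2.trans (mul_le_mul_right h3 _)) _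
      _ = _ := by ring
  exact (ENNReal.mul_le_mul_iff_right hb0 hbt).1 h4

/-- By Tonelli, for fixed t the double integral is that of h(z) m(B(z, 2tr)), at most C (2tr)^α ∫ h.
The relation between η and α turns the remaining power of t into t^(η-1), with integral 1/η. -/
theorem lintegral_lintegral_ball_le (ν : Measure E) [SFinite ν] (m : Measure E) [SFinite m]
    {C α : ℝ}
    (hm : ∀ x r, 0 < r → m (Metric.ball x r) ≤ ENNReal.ofReal (C * r ^ α))
    {h : E → ℝ≥0∞} (hh : Measurable h) {r d η : ℝ} (hr : 0 < r) (hη : 0 < η)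
    (hηd : 2 * η = α - (d - 2)) :
    ∫⁻ x, (∫⁻ t in Set.Ioo (0 : ℝ) 1, ENNReal.ofReal (t ^ (1 - η - d)) *
      ∫⁻ z in Metric.ball x (2 * t * r), h z ∂ν) ∂m ≤
      ENNReal.ofReal (C * (2 * r) ^ α * η⁻¹) * ∫⁻ z, h z ∂ν := by
  have hwm : ∀ s : ℝ, Measurable fun t : ℝ => ENNReal.ofReal (t ^ s) := fun s =>
    (measurable_id.pow_const s).ennreal_ofReal
  have hset : MeasurableSet {q : (E × ℝ) × E | dist q.2 q.1.1 < 2 * q.1.2 * r} :=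
    (isOpen_lt (by fun_prop) (by fun_prop)).measurableSet
  have hf : Measurable fun q : (E × ℝ) × E =>
      (Metric.ball q.1.1 (2 * q.1.2 * r)).indicator h q.2 :=
    (hh.comp measurable_snd).indicator hset
  have hi : ∀ x ρ, ∫⁻ z in Metric.ball x ρ, h z ∂ν =
      ∫⁻ z, (Metric.ball x ρ).indicator h z ∂ν := fun x ρ =>
    (lintegral_indicator measurableSet_ball _).symm
  simp only [hi]
  rw [lintegral_lintegral_swap]
  swap
  · exact (((hwm _).comp measurable_snd).mul hf.lintegral_prod_right').aemeasurable
  have hstep : ∀ t ∈ Set.Ioo (0 : ℝ) 1,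
      ∫⁻ x, ENNReal.ofReal (t ^ (1 - η - d)) *
        ∫⁻ z, (Metric.ball x (2 * t * r)).indicator h z ∂ν ∂m ≤
      ENNReal.ofReal (t ^ (η - 1)) * (ENNReal.ofReal (C * (2 * r) ^ α) * ∫⁻ z, h z ∂ν) := by
    intro t ht
    have ht0 : 0 < t := ht.1
    rw [lintegral_const_mul' _ _ ENNReal.ofReal_ne_top, lintegral_lintegral_swap]
    swap
    · exact (hf.comp (f := fun p : E × E => ((p.1, t), p.2)) (by fun_prop)).aemeasurable
    have e : t ^ (η - 1) = t ^ (1 - η - d) * t ^ α := by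
      rw [← Real.rpow_add ht0]; congr 1; linarith
    rw [e, ENNReal.ofReal_mul (by positivity), mul_assoc (ENNReal.ofReal _)]
    refine mul_le_mul' le_rfl ?_
    rw [← mul_assoc, ← ENNReal.ofReal_mul (by positivity),
      ← lintegral_const_mul' _ _ ENNReal.ofReal_ne_top]
    gcongr with z
    have : ∀ x, (Metric.ball x (2 * t * r)).indicator h z =
        (Metric.ball z (2 * t * r)).indicator (fun _ => h z) x := by
      intro x
      simp only [Set.indicator, Metric.mem_ball, dist_comm]
    simp only [this]
    rw [lintegral_indicator measurableSet_ball, setLIntegral_const, mul_comm]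
    gcongr
    refine (hm z _ (by positivity)).trans_eq ?_
    rw [mul_assoc 2 t r, mul_left_comm 2 t r, Real.mul_rpow ht0.le (by positivity)]
    congr 1
    ring
  refine (setLIntegral_mono' measurableSet_Ioo hstep).trans_eq ?_
  rw [lintegral_mul_const _ (hwm _), lintegral_rpow_sub_one hη, ← mul_assoc,
    ← ENNReal.ofReal_mul (by positivity), mul_comm η⁻¹]

theorem exists_finset_lintegral_sq_enorm_le (ν : Measure E) [ν.IsAddHaarMeasure]
    (F : Type*) [NormedAddCommGroup F] [NormedSpace ℝ F] [CompleteSpace F]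
    (m : Measure E) [IsFiniteMeasure m] {K : Set E} (hK : IsCompact K) (hmK : m Kᶜ = 0) {C α : ℝ}
    (hm : ∀ x r, 0 < r → m (Metric.ball x r) ≤ ENNReal.ofReal (C * r ^ α))
    (hα : (Module.finrank ℝ E : ℝ) - 2 < α) {ε : ℝ} (hε : 0 < ε) :
    ∃ (s : Finset E) (r C' : ℝ), 0 < r ∧ 0 ≤ C' ∧ ∀ φ : E → F, ContDiff ℝ 1 φ →
      ∫⁻ x, ‖φ x‖ₑ ^ 2 ∂m ≤ ENNReal.ofReal ε * ∫⁻ x, ‖fderiv ℝ φ x‖ₑ ^ 2 ∂ν +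
        ENNReal.ofReal C' * ∑ c ∈ s, ‖⨍ y in Metric.ball c r, φ y ∂ν‖ₑ ^ 2 := by
  set d : ℝ := ↑(Module.finrank ℝ E) with hd
  set η := (α - (d - 2)) / 2 with hη'
  have hη : 0 < η := by rw [hη']; linarith
  have hV0 : ν (Metric.ball 0 1) ≠ 0 := (Metric.measure_ball_pos ν 0 one_pos).ne'
  have hVt : ν (Metric.ball 0 1) ≠ ⊤ := measure_ball_lt_top.ne
  set v := (ν (Metric.ball 0 1)).toReal with hv'
  have hv : 0 < v := ENNReal.toReal_pos hV0 hVt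
  set D := 8 * C * 2 ^ α * η⁻¹ ^ 2 * v⁻¹ with hD
  -- D r^(2η) is the constant in front of the Dirichlet integral at the end; it tends to 0 with r
  -- because α > d - 2 makes η positive.
  obtain ⟨r, hrε, hr⟩ : ∃ r, D * r ^ (2 * η) ≤ ε ∧ 0 < r := by
    have h1 : Filter.Tendsto (fun r : ℝ => D * r ^ (2 * η)) (nhdsWithin 0 (Set.Ioi 0))
        (nhds 0) := by
      have : ContinuousAt (fun r : ℝ => D * r ^ (2 * η)) 0 :=
        continuousAt_const.mul (Real.continuousAt_rpow_const _ _ (Or.inr (by positivity)))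
      have h2 := this.tendsto
      rw [Real.zero_rpow (by positivity), mul_zero] at h2
      exact h2.mono_left nhdsWithin_le_nhds
    exact ((h1.eventually_le_const hε).and self_mem_nhdsWithin).exists
  have hball : ∀ c, ν (Metric.ball c r) = ENNReal.ofReal (r ^ d * v) := by
    intro c
    rw [Measure.addHaar_ball_of_pos ν c hr, ENNReal.ofReal_mul (by positivity), hv',
      ENNReal.ofReal_toReal hVt, hd, Real.rpow_natCast]
  obtain ⟨s, -, hs⟩ := hK.elim_nhds_subcover (fun c => Metric.ball c r)
    (fun c _ => Metric.ball_mem_nhds c hr)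
  refine ⟨s, r, 2 * (m Set.univ).toReal, hr, by positivity, fun φ hφ => ?_⟩
  set A : E → F := fun c => ⨍ y in Metric.ball c r, φ y ∂ν with hA
  set G : E → ℝ≥0∞ := fun x => ∫⁻ t in Set.Ioo (0 : ℝ) 1, ENNReal.ofReal (t ^ (1 - η - d)) *
      ∫⁻ z in Metric.ball x (2 * t * r), ‖fderiv ℝ φ z‖ₑ ^ 2 ∂ν with hG
  -- The 8 is 4 from (2r)² times 2 from |a + b|² ≤ 2(|a|² + |b|²).
  set M : ℝ := 8 * r ^ 2 * η⁻¹ * (r ^ d * v)⁻¹ with hM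
  have hpt : ∀ x ∈ K, ‖φ x‖ₑ ^ 2 ≤ ENNReal.ofReal M * G x + 2 * ∑ c ∈ s, ‖A c‖ₑ ^ 2 := by
    intro x hx
    obtain ⟨c, hc, hxc⟩ := Set.mem_iUnion₂.1 (hs hx)
    have h1 := measure_ball_mul_sq_enorm_sub_average_le ν hφ (Metric.mem_ball.1 hxc) hη
    rw [hball] at h1
    have h2 : ‖φ x - A c‖ₑ ^ 2 ≤ ENNReal.ofReal (M / 2) * G x := by
      have hb : 0 < r ^ d * v := by positivity
      refine (ENNReal.mul_le_mul_iff_right (ENNReal.ofReal_pos.2 hb).ne'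
        ENNReal.ofReal_ne_top).1 (h1.trans_eq ?_)
      rw [← mul_assoc, ← ENNReal.ofReal_mul hb.le, ← ENNReal.ofReal_pow (by positivity),
        ← ENNReal.ofReal_mul (by positivity)]
      congr 2
      rw [hM]
      field_simp
      ring
    have h3 : ‖φ x‖ₑ ^ 2 ≤ 2 * (‖φ x - A c‖ₑ ^ 2 + ‖A c‖ₑ ^ 2) := by
      have h4 : ‖φ x‖ₑ ≤ ‖φ x - A c‖ₑ + ‖A c‖ₑ := by
        simpa using enorm_add_le (φ x - A c) (A c)
      refine (pow_le_pow_left' h4 2).trans ?_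
      have h5 := ENNReal.rpow_add_le_mul_rpow_add_rpow ‖φ x - A c‖ₑ ‖A c‖ₑ
        (p := 2) (by norm_num)
      norm_num at h5
      exact h5
    refine h3.trans ?_
    rw [mul_add]
    refine add_le_add ?_ (mul_le_mul' le_rfl
      (Finset.single_le_sum (f := fun c => ‖A c‖ₑ ^ 2) (fun _ _ => zero_le) hc))
    refine (mul_le_mul' le_rfl h2).trans_eq ?_
    rw [← mul_assoc, ← ENNReal.ofReal_ofNat 2, ← ENNReal.ofReal_mul (by norm_num)]
    congr 2
    ring
  have hKae : ∀ᵐ x ∂m, x ∈ K := hmK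
  calc ∫⁻ x, ‖φ x‖ₑ ^ 2 ∂m
      ≤ ∫⁻ x, (ENNReal.ofReal M * G x + 2 * ∑ c ∈ s, ‖A c‖ₑ ^ 2) ∂m :=
        lintegral_mono_ae (hKae.mono hpt)
    _ = ENNReal.ofReal M * ∫⁻ x, G x ∂m + 2 * (∑ c ∈ s, ‖A c‖ₑ ^ 2) * m Set.univ := by
        rw [lintegral_add_right _ measurable_const, lintegral_const,
          lintegral_const_mul' _ _ ENNReal.ofReal_ne_top]
    _ ≤ ENNReal.ofReal M * (ENNReal.ofReal (C * (2 * r) ^ α * η⁻¹) *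
          ∫⁻ x, ‖fderiv ℝ φ x‖ₑ ^ 2 ∂ν) + 2 * (∑ c ∈ s, ‖A c‖ₑ ^ 2) * m Set.univ := by
        refine add_le_add (mul_le_mul' le_rfl ?_) le_rfl
        exact lintegral_lintegral_ball_le ν m hm
          ((hφ.continuous_fderiv (by simp)).enorm.measurable.pow_const 2) hr hη (by rw [hη']; ring)
    _ ≤ _ := by
        refine add_le_add ?_ (le_of_eq ?_)
        · rw [← mul_assoc, ← ENNReal.ofReal_mul (by positivity)]
          refine mul_le_mul' (ENNReal.ofReal_le_ofReal (hrε.trans' (le_of_eq ?_))) le_rfl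
          have e1 : 2 * η = 2 + α - d := by rw [hη']; ring
          rw [e1, Real.rpow_sub hr, Real.rpow_add hr, Real.mul_rpow (by norm_num) hr.le, hM, hD,
            Real.rpow_two]
          field_simp
        · rw [ENNReal.ofReal_mul (by norm_num), ENNReal.ofReal_toReal (measure_ne_top _ _),
            ENNReal.ofReal_ofNat]
          ring

end TraceInequality

/-! ### Coercivity up to finite rank and the Fredholm alternative. -/

section Fredholm

variable {V : Type*} [NormedAddCommGroup V] [InnerProductSpace ℂ V]

theorem isCompactOperator_sum_innerSL_smulRight {ι : Type*} (t : Finset ι) (k : ι → V) :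
    IsCompactOperator (∑ j ∈ t, (innerSL ℂ (k j)).smulRight (k j) : V →L[ℂ] V) := by
  have h : ∑ j ∈ t, (innerSL ℂ (k j)).smulRight (k j) ∈ compactOperator (RingHom.id ℂ) V V := by
    refine sum_mem fun j _ => ?_
    have h1 : IsCompactOperator (innerSL ℂ (k j)) :=
      isCompactOperator_of_locallyCompactSpace_dom (innerSL ℂ (k j))
    exact h1.clm_comp (ContinuousLinearMap.toSpanSingleton ℂ (k j))
  exact h

/-- An injective bounded operator whose form is coercive up to finitely many functionals is
invertible. -/
theorem isUnit_of_injective_of_coercive_add_sum [CompleteSpace V] {ι : Type*} (t : Finset ι) (k : ι → V)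
    (A : V →L[ℂ] V) (hA : ∀ u, A u = 0 → u = 0) {c : ℝ} (hc : 0 < c)
    (h : ∀ u, c * ‖u‖ ^ 2 ≤ (inner ℂ (A u) u).re + ∑ j ∈ t, ‖inner ℂ (k j) u‖ ^ 2) :
    IsUnit A := by
  set K : V →L[ℂ] V := ∑ j ∈ t, (innerSL ℂ (k j)).smulRight (k j) with hK
  have hKu : ∀ u, (inner ℂ (K u) u).re = ∑ j ∈ t, ‖inner ℂ (k j) u‖ ^ 2 := by
    intro u
    simp only [hK, sum_apply, ContinuousLinearMap.smulRight_apply,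
      innerSL_apply_apply, sum_inner, inner_smul_left, Complex.re_sum]
    refine Finset.sum_congr rfl fun j _ => ?_
    rw [← Complex.normSq_eq_conj_mul_self, Complex.ofReal_re, Complex.normSq_eq_norm_sq]
  obtain ⟨U, hU⟩ : IsUnit (A + K) := by
    refine ContinuousLinearMap.isUnit_of_forall_le_norm_inner_map (A + K) (c := ⟨c, hc.le⟩) hc
      fun u => ?_
    refine le_trans ?_ (Complex.re_le_norm _)
    rw [add_apply, inner_add_left, Complex.add_re, hKu]
    exact (mul_comm _ _).trans_le (h u)
  -- With U = A + K invertible by Lax–Milgram, A = U(1 - T) where T = U⁻¹K is compact. If 1 is an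
  -- eigenvalue of T, an eigenvector lies in the kernel of A; otherwise 1 - T is invertible.
  set T : V →L[ℂ] V := (↑U⁻¹ : V →L[ℂ] V) * K with hT
  have hTc : IsCompactOperator T :=
    (isCompactOperator_sum_innerSL_smulRight t k).clm_comp (↑U⁻¹ : V →L[ℂ] V)
  have hUT : (↑U : V →L[ℂ] V) * T = K := by rw [hT, Units.mul_inv_cancel_left]
  rcases hTc.hasEigenvalue_or_mem_resolventSet (one_ne_zero (α := ℂ)) with h1 | h1
  · obtain ⟨u, hu⟩ := h1.exists_hasEigenvector
    refine absurd (hA u ?_) hu.2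
    have h2 : T u = u := by simpa using hu.apply_eq_smul
    have h3 : (A + K) u = K u := by
      conv_rhs => rw [← hUT]
      rw [mul_apply_eq_comp, h2, hU]
    simpa using h3
  · rw [spectrum.mem_resolventSet_iff, map_one] at h1
    have h2 : A = ↑U * (1 - T) := by rw [mul_sub, mul_one, hUT, hU, add_sub_cancel_right]
    rw [h2]
    exact U.isUnit.mul h1

end Fredholm

/-! ### Auxiliary facts on L² and test functions. -/

section L2

variable {n : ℕ}

theorem lintegral_sq_enorm_eq_ofReal {X F : Type*} [MeasurableSpace X] {m : Measure X}
    [NormedAddCommGroup F] (f : Lp F 2 m) :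
    ∫⁻ x, ‖f x‖ₑ ^ 2 ∂m = ENNReal.ofReal (‖f‖ ^ 2) := by
  have h := eLpNorm_nnreal_pow_eq_lintegral (μ := m) (f := f) (p := 2) (by norm_num)
  rw [← Real.enorm_of_nonneg (by positivity), enorm_pow, enorm_norm, Lp.enorm_def]
  simpa using h.symm

/-- Cauchy–Schwarz in coordinates; it passes from the operator norm of the derivative, used in the
trace inequality, to the partial derivatives, used in the form. -/
theorem sq_norm_le_sum_sq_norm_apply_single (L : EuclideanSpace ℝ (Fin n) →L[ℝ] ℂ) :
    ‖L‖ ^ 2 ≤ ∑ i, ‖L (EuclideanSpace.single i 1)‖ ^ 2 := by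
  rw [← Real.le_sqrt (norm_nonneg _)  (by positivity)]
  refine L.opNorm_le_bound (Real.sqrt_nonneg _) fun v => ?_
  have hv : L v = ∑ i, v i • L (EuclideanSpace.single i 1) := by
    conv_lhs => rw [← (EuclideanSpace.basisFun (Fin n) ℝ).sum_repr v]
    simp
  rw [hv, EuclideanSpace.norm_eq v]
  refine (norm_sum_le _ _).trans ?_
  simp only [norm_smul]
  refine (Real.sum_mul_le_sqrt_mul_sqrt _ _ _).trans_eq (mul_comm _ _)

theorem inner_toLp_ofReal {ψ : EuclideanSpace ℝ (Fin n) → ℝ}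
    (hψ : MemLp (fun x => (ψ x : ℂ)) 2 volume) (f : L2 n) :
    inner ℂ (hψ.toLp _) f = ∫ x, ψ x • f x := by
  rw [L2.inner_def]
  refine integral_congr_ae ?_
  filter_upwards [hψ.coeFn_toLp] with x hx
  rw [hx]
  simp [mul_comm]

theorem memLp_ofReal_of_hasCompactSupport {m : Measure (EuclideanSpace ℝ (Fin n))}
    [IsFiniteMeasureOnCompacts m]
    {ψ : EuclideanSpace ℝ (Fin n) → ℝ} (hψ : Continuous ψ) (hc : HasCompactSupport ψ) :
    MemLp (fun x => (ψ x : ℂ)) 2 m :=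
  (Complex.continuous_ofReal.comp hψ).memLp_of_hasCompactSupport
    (hc.comp_left (g := ((↑) : ℝ → ℂ)) Complex.ofReal_zero)

theorem eq_zero_of_forall_integral_smul_eq_zero (f : L2 n)
    (h : ∀ ψ : EuclideanSpace ℝ (Fin n) → ℝ, ContDiff ℝ ∞ ψ → HasCompactSupport ψ →
      ∫ x, ψ x • f x = 0) : f = 0 := by
  rw [Lp.eq_zero_iff_ae_eq_zero]
  exact ae_eq_zero_of_integral_contDiff_smul_eq_zero
    ((Lp.memLp f).locallyIntegrable (by norm_num)) h

end L2

/-! ### The trace inequality and uniqueness on the form domain. -/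

section FormDomain

variable {n : ℕ} {μ : SignedMeasure (EuclideanSpace ℝ (Fin n))}

theorem setAverage_eq_inner (c : EuclideanSpace ℝ (Fin n)) (r : ℝ) (f : L2 n) :
    ⨍ x in Metric.ball c r, f x = inner ℂ (((volume.real (Metric.ball c r))⁻¹ : ℂ) •
      indicatorConstLp 2 (measurableSet_ball (x := c) (ε := r)) measure_ball_lt_top.ne (1 : ℂ)) f := by
  rw [inner_smul_left, L2.inner_indicatorConstLp_one, setAverage_eq, RCLike.real_smul_eq_coe_mul]
  simp

/-- The `L²(|μ|)` norm is bounded on the form domain by an arbitrarily small multiple of the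
Dirichlet integral, up to finitely many functionals that are bounded on `L²(ℝⁿ)`. -/
theorem exists_finset_sq_norm_le {α : ℝ} (hα : (n : ℝ) - 2 < α) (hμ : CompactlySupported μ)
    (hdim : IsDimensional α μ) {ε : ℝ} (hε : 0 < ε) :
    ∃ (s : Finset (EuclideanSpace ℝ (Fin n))) (e : EuclideanSpace ℝ (Fin n) → L2 n),
      ∀ w ∈ formDomain μ, ‖w.2.2‖ ^ 2 ≤ ε * ∑ i, ‖w.2.1 i‖ ^ 2 +
        ∑ c ∈ s, ‖inner ℂ (e c) w.1‖ ^ 2 := by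
  obtain ⟨K, hK, hμK⟩ := hμ
  obtain ⟨C, hC⟩ := hdim
  obtain ⟨s, r, C', hr, hC', h⟩ := exists_finset_lintegral_sq_enorm_le volume ℂ μ.totalVariation hK
    hμK hC (by simpa using hα) hε
  set e : EuclideanSpace ℝ (Fin n) → L2 n := fun c => ((volume.real (Metric.ball c r))⁻¹ : ℂ) •
      indicatorConstLp 2 (measurableSet_ball (x := c) (ε := r)) measure_ball_lt_top.ne (1 : ℂ) with he
  -- The vectors represent the means over the balls; the square root absorbs the constant C'. Both
  -- sides are continuous on triples, so test triples suffice.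
  refine ⟨s, fun c => (Real.sqrt C' : ℂ) • e c, fun w hw => ?_⟩
  have hclosed : IsClosed {w : Triple μ | ‖w.2.2‖ ^ 2 ≤ ε * ∑ i, ‖w.2.1 i‖ ^ 2 +
        ∑ c ∈ s, ‖inner ℂ ((Real.sqrt C' : ℂ) • e c) w.1‖ ^ 2} :=
    isClosed_le (by fun_prop) (by fun_prop)
  refine closure_minimal ?_ hclosed hw
  rintro w ⟨φ, hφ, hφc, h1, h2, h3⟩
  have key := h φ (hφ.of_le (by simp))
  have e1 : ∫⁻ x, ‖φ x‖ₑ ^ 2 ∂μ.totalVariation = ENNReal.ofReal (‖w.2.2‖ ^ 2) := by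
    rw [← lintegral_sq_enorm_eq_ofReal]
    exact lintegral_congr_ae (h3.mono fun x hx => by simp only [hx])
  have e2 : ∫⁻ x, ‖fderiv ℝ φ x‖ₑ ^ 2 ≤ ENNReal.ofReal (∑ i, ‖w.2.1 i‖ ^ 2) := by
    rw [ENNReal.ofReal_sum_of_nonneg fun _ _ => by positivity]
    simp_rw [← lintegral_sq_enorm_eq_ofReal]
    rw [← lintegral_finsetSum' _ fun i _ =>
      ((Lp.aestronglyMeasurable (w.2.1 i)).enorm.pow_const 2)]
    refine lintegral_mono_ae ?_
    filter_upwards [ae_all_iff.2 h2] with x hx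
    simp only [hx, ← ofReal_norm, ← ENNReal.ofReal_pow (norm_nonneg _)]
    rw [← ENNReal.ofReal_sum_of_nonneg fun _ _ => by positivity]
    exact ENNReal.ofReal_le_ofReal (sq_norm_le_sum_sq_norm_apply_single _)
  have e3 : ∀ c, ⨍ x in Metric.ball c r, φ x = inner ℂ (e c) w.1 := by
    intro c
    rw [he, ← setAverage_eq_inner]
    refine average_congr (ae_restrict_of_ae (h1.symm))
  rw [e1] at key
  simp only [e3] at key
  have e4 : ENNReal.ofReal C' * ∑ c ∈ s, ‖inner ℂ (e c) w.1‖ₑ ^ 2 =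
      ENNReal.ofReal (∑ c ∈ s, ‖inner ℂ ((Real.sqrt C' : ℂ) • e c) w.1‖ ^ 2) := by
    rw [ENNReal.ofReal_sum_of_nonneg fun _ _ => by positivity, Finset.mul_sum]
    refine Finset.sum_congr rfl fun c _ => ?_
    rw [inner_smul_left (e c) w.1, norm_mul, mul_pow, ENNReal.ofReal_mul (by positivity)]
    congr 1
    · simp [Real.sq_sqrt hC']
    · rw [ENNReal.ofReal_pow (norm_nonneg _), ofReal_norm]
  rw [e4] at key
  have key2 := key.trans (add_le_add_left (mul_le_mul' le_rfl e2) _)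
  rw [← ENNReal.ofReal_mul hε.le, ← ENNReal.ofReal_add (by positivity) (by positivity),
    ENNReal.ofReal_le_ofReal_iff (by positivity)] at key2
  exact key2

theorem isClosed_formDomain : IsClosed (formDomain μ : Set (Triple μ)) :=
  Submodule.isClosed_topologicalClosure _

theorem exists_mem_formDomain {ψ : EuclideanSpace ℝ (Fin n) → ℝ} (hψ : ContDiff ℝ ∞ ψ)
    (hc : HasCompactSupport ψ) (h2 : MemLp (fun x => (ψ x : ℂ)) 2 volume) :
    ∃ w ∈ formDomain μ, w.1 = h2.toLp _ := by
  have hφ : ContDiff ℝ ∞ fun x => (ψ x : ℂ) := Complex.ofRealCLM.contDiff.comp hψ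
  have hφc : HasCompactSupport fun x => (ψ x : ℂ) :=
    hc.comp_left (g := ((↑) : ℝ → ℂ)) Complex.ofReal_zero
  have hd : ∀ i : Fin n, MemLp (fun x => fderiv ℝ (fun x => (ψ x : ℂ)) x
      (EuclideanSpace.single i 1)) 2 volume := fun i =>
    ((hφ.continuous_fderiv (by simp)).clm_apply continuous_const).memLp_of_hasCompactSupport
      (hφc.fderiv_apply ℝ _)
  have h3 : MemLp (fun x => (ψ x : ℂ)) 2 μ.totalVariation :=
    memLp_ofReal_of_hasCompactSupport hψ.continuous hc
  exact ⟨(h2.toLp _, fun i => (hd i).toLp _, h3.toLp _), subset_closure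
    ⟨_, hφ, hφc, h2.coeFn_toLp, fun i => (hd i).coeFn_toLp, h3.coeFn_toLp⟩, rfl⟩

theorem eq_zero_of_forall_mem_formDomain_inner_eq_zero (f : L2 n)
    (h : ∀ v ∈ formDomain μ, inner ℂ v.1 f = 0) : f = 0 := by
  refine eq_zero_of_forall_integral_smul_eq_zero f fun ψ hψ hc => ?_
  have h2 := memLp_ofReal_of_hasCompactSupport (m := volume) hψ.continuous hc
  obtain ⟨w, hw, hw1⟩ := exists_mem_formDomain (μ := μ) hψ hc h2
  rw [← inner_toLp_ofReal h2, ← hw1]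
  exact h w hw

/-- Integration by parts for test triples, preserved under limits because both sides are continuous:
the second component is the weak gradient of the first. -/
theorem integral_smul_gradient_eq {w : Triple μ} (hw : w ∈ formDomain μ) (i : Fin n)
    {ψ : EuclideanSpace ℝ (Fin n) → ℝ} (hψ : ContDiff ℝ ∞ ψ) (hc : HasCompactSupport ψ) :
    ∫ x, ψ x • w.2.1 i x = - ∫ x, fderiv ℝ ψ x (EuclideanSpace.single i 1) • w.1 x := by
  have hdc : Continuous fun x => fderiv ℝ ψ x (EuclideanSpace.single i 1) :=
    (hψ.continuous_fderiv (by simp)).clm_apply continuous_const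
  have h2 := memLp_ofReal_of_hasCompactSupport (m := volume) hψ.continuous hc
  have h3 := memLp_ofReal_of_hasCompactSupport (m := volume) hdc (hc.fderiv_apply ℝ _)
  rw [← inner_toLp_ofReal h2, ← inner_toLp_ofReal h3]
  have hclosed : IsClosed {w : Triple μ | inner ℂ (h2.toLp _) (w.2.1 i) =
      - inner ℂ (h3.toLp _) w.1} := isClosed_eq (by fun_prop) (by fun_prop)
  refine closure_minimal ?_ hclosed hw
  rintro w ⟨φ, hφ, hφc, k1, k2, -⟩
  change inner ℂ (h2.toLp _) (w.2.1 i) = - inner ℂ (h3.toLp _) w.1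
  rw [inner_toLp_ofReal h2, inner_toLp_ofReal h3,
    integral_congr_ae ((k2 i).mono fun x hx => congrArg (ψ x • ·) hx),
    integral_congr_ae (k1.mono fun x hx =>
      congrArg (fderiv ℝ ψ x (EuclideanSpace.single i 1) • ·) hx)]
  have hdφ : Continuous fun x => fderiv ℝ φ x (EuclideanSpace.single i 1) :=
    (hφ.continuous_fderiv (by simp)).clm_apply continuous_const
  exact integral_smul_fderiv_eq_neg_fderiv_smul_of_integrable
    ((hdc.smul hφ.continuous).integrable_of_hasCompactSupport hφc.smul_left)
    ((hψ.continuous.smul hdφ).integrable_of_hasCompactSupport hc.smul_right)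
    ((hψ.continuous.smul hφ.continuous).integrable_of_hasCompactSupport hc.smul_right)
    (fun x _ => hψ.differentiable (by simp) x) fun x _ => hφ.differentiable (by simp) x

/-- The weak gradient of 0 is 0, and the trace inequality then kills the |μ|-component. So an
element of the form domain is determined by its L² function. -/
theorem eq_zero_of_fst_eq_zero {α : ℝ} (hα : (n : ℝ) - 2 < α) (hμ : CompactlySupported μ)
    (hdim : IsDimensional α μ) {w : Triple μ} (hw : w ∈ formDomain μ) (h : w.1 = 0) : w = 0 := by
  have h1 : w.2.1 = 0 := by
    funext i
    refine eq_zero_of_forall_integral_smul_eq_zero _ fun ψ hψ hc => ?_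
    rw [integral_smul_gradient_eq hw i hψ hc, h, neg_eq_zero]
    refine integral_eq_zero_of_ae ?_
    filter_upwards with x
    simp
  obtain ⟨s, e, hse⟩ := exists_finset_sq_norm_le hα hμ hdim one_pos
  have h2 := hse w hw
  simp only [h1, h, Pi.zero_apply, norm_zero, inner_zero_right] at h2
  have h3 : w.2.2 = 0 := by
    rw [← norm_eq_zero]
    refine pow_eq_zero_iff two_ne_zero |>.1 (le_antisymm (by simpa using h2) (by positivity))
  exact Prod.ext h (Prod.ext h1 h3)

end FormDomain

/-! ### Symmetry and bounds of the form. -/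

section Form

variable {n : ℕ} {μ : SignedMeasure (EuclideanSpace ℝ (Fin n))}

theorem conj_form (u v : Triple μ) : conj (form μ u v) = form μ v u := by
  simp only [form, map_add, map_sub, map_sum, inner_conj_symm, ← integral_conj, map_mul,
    Complex.conj_conj, mul_comm]

theorem norm_integral_sub_integral_le (f g : Lp ℂ 2 μ.totalVariation) :
    ‖(∫ x, f x * conj (g x) ∂μ.toJordanDecomposition.posPart) -
      ∫ x, f x * conj (g x) ∂μ.toJordanDecomposition.negPart‖ ≤ ‖f‖ * ‖g‖ := by
  have hle : ENNReal.ofReal ‖(∫ x, f x * conj (g x) ∂μ.toJordanDecomposition.posPart) -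
      ∫ x, f x * conj (g x) ∂μ.toJordanDecomposition.negPart‖ ≤ ENNReal.ofReal (‖f‖ * ‖g‖) := by
    rw [ofReal_norm, ENNReal.ofReal_mul (norm_nonneg _), ofReal_norm, ofReal_norm]
    refine (enorm_sub_le.trans (add_le_add (enorm_integral_le_lintegral_enorm _)
      (enorm_integral_le_lintegral_enorm _))).trans ?_
    rw [← lintegral_add_measure]
    -- The total variation is by definition the sum of the positive and negative parts.
    change ∫⁻ x, ‖f x * conj (g x)‖ₑ ∂μ.totalVariation ≤ _
    simp only [enorm_mul, RCLike.enorm_conj]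
    refine (ENNReal.lintegral_mul_le_Lp_mul_Lq μ.totalVariation Real.HolderConjugate.two_two
      (Lp.aestronglyMeasurable f).enorm (Lp.aestronglyMeasurable g).enorm).trans_eq ?_
    simp [Lp.enorm_def, eLpNorm_eq_lintegral_rpow_enorm_toReal]
  exact (ENNReal.ofReal_le_ofReal_iff (by positivity)).1 hle

theorem le_re_form_self (u : Triple μ) :
    ∑ i, ‖u.2.1 i‖ ^ 2 - ‖u.2.2‖ ^ 2 ≤ (form μ u u).re := by
  have h := (Complex.abs_re_le_norm _).trans (norm_integral_sub_integral_le u.2.2 u.2.2)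
  have h1 := (abs_le.1 h).1
  rw [form, Complex.add_re, Complex.re_sum]
  have h2 : ∀ i, (inner ℂ (u.2.1 i) (u.2.1 i)).re = ‖u.2.1 i‖ ^ 2 := fun i => by
    rw [inner_self_eq_norm_sq_to_K]
    norm_cast
  simp only [h2]
  nlinarith

theorem norm_form_le (u v : Triple μ) :
    ‖form μ u v‖ ≤ ∑ i, ‖u.2.1 i‖ * ‖v.2.1 i‖ + ‖u.2.2‖ * ‖v.2.2‖ := by
  refine (norm_add_le _ _).trans (add_le_add ((norm_sum_le _ _).trans ?_)
    (norm_integral_sub_integral_le _ _))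
  exact Finset.sum_le_sum fun i _ => (norm_inner_le_norm _ _).trans_eq (mul_comm _ _)

end Form

/-! ### The form domain as a Hilbert space, and the operator representing q - E on it. -/

section HilbertFormDomain

variable {n : ℕ}

/-- `L²(ℝⁿ) × L²(ℝⁿ)ⁿ × L²(|μ|)` with its Hilbert space norm. -/
abbrev HilbertTriple (μ : SignedMeasure (EuclideanSpace ℝ (Fin n))) : Type :=
  WithLp 2 (L2 n × WithLp 2 (PiLp 2 (fun _ : Fin n => L2 n) × Lp ℂ 2 μ.totalVariation))

/-- The identity from the Hilbert space of triples to the product. -/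
def hilbertTripleEquiv (μ : SignedMeasure (EuclideanSpace ℝ (Fin n))) :
    HilbertTriple μ ≃L[ℂ] Triple μ :=
  (WithLp.prodContinuousLinearEquiv 2 ℂ _ _).trans
    ((ContinuousLinearEquiv.refl ℂ (L2 n)).prodCongr
      ((WithLp.prodContinuousLinearEquiv 2 ℂ _ _).trans
        ((PiLp.continuousLinearEquiv 2 ℂ (fun _ : Fin n => L2 n)).prodCongr
          (ContinuousLinearEquiv.refl ℂ _))))

/-- The form domain as a subspace of the Hilbert space of triples. -/
def hilbertFormDomain (μ : SignedMeasure (EuclideanSpace ℝ (Fin n))) :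
    Submodule ℂ (HilbertTriple μ) :=
  (formDomain μ).comap (hilbertTripleEquiv μ : HilbertTriple μ →ₗ[ℂ] Triple μ)

/-- The form domain with the norm `‖u‖² + ‖∇u‖² + ‖u‖²_{L²(|μ|)}`. -/
def FormSpace (μ : SignedMeasure (EuclideanSpace ℝ (Fin n))) : Type := hilbertFormDomain μ

variable {μ : SignedMeasure (EuclideanSpace ℝ (Fin n))}

instance : NormedAddCommGroup (FormSpace μ) :=
  inferInstanceAs (NormedAddCommGroup (hilbertFormDomain μ))

instance : InnerProductSpace ℂ (FormSpace μ) :=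
  inferInstanceAs (InnerProductSpace ℂ (hilbertFormDomain μ))

instance : CompleteSpace (FormSpace μ) :=
  (isClosed_formDomain.preimage (hilbertTripleEquiv μ).continuous).completeSpace_coe

variable (μ) in
/-- The triple that corresponds to an element of the form domain. -/
def toTriple : FormSpace μ →L[ℂ] Triple μ :=
  (hilbertTripleEquiv μ : HilbertTriple μ →L[ℂ] Triple μ).comp (hilbertFormDomain μ).subtypeL

theorem toTriple_mem (u : FormSpace μ) : toTriple μ u ∈ formDomain μ := by
  obtain ⟨u, hu⟩ := u
  exact hu

theorem toTriple_injective : Function.Injective (toTriple μ) :=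
  (hilbertTripleEquiv μ).injective.comp Subtype.val_injective

theorem exists_toTriple_eq {w : Triple μ} (hw : w ∈ formDomain μ) :
    ∃ v : FormSpace μ, toTriple μ v = w :=
  ⟨⟨(hilbertTripleEquiv μ).symm w, by simpa [hilbertFormDomain] using hw⟩,
    (hilbertTripleEquiv μ).apply_symm_apply w⟩

theorem sq_norm_eq_toTriple (u : FormSpace μ) :
    ‖u‖ ^ 2 = ‖(toTriple μ u).1‖ ^ 2 + (∑ i, ‖(toTriple μ u).2.1 i‖ ^ 2 +
      ‖(toTriple μ u).2.2‖ ^ 2) := by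
  obtain ⟨u, hu⟩ := u
  change ‖u‖ ^ 2 = _
  rw [WithLp.prod_norm_sq_eq_of_L2, WithLp.prod_norm_sq_eq_of_L2, PiLp.norm_sq_eq_of_L2]
  rfl

variable (μ) in
/-- The inclusion of the form domain into `L²(ℝⁿ)`. -/
def inclusion : FormSpace μ →L[ℂ] L2 n :=
  (ContinuousLinearMap.fst ℂ _ _).comp (toTriple μ)

theorem inclusion_apply (u : FormSpace μ) : inclusion μ u = (toTriple μ u).1 := rfl

theorem norm_form_toTriple_le (u v : FormSpace μ) :
    ‖form μ (toTriple μ u) (toTriple μ v)‖ ≤ (n + 1) * ‖u‖ * ‖v‖ := by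
  have h1 : ∀ (u : FormSpace μ) i, ‖(toTriple μ u).2.1 i‖ ≤ ‖u‖ := fun u i => by
    refine (sq_le_sq₀ (norm_nonneg _) (norm_nonneg _)).1 ?_
    rw [sq_norm_eq_toTriple]
    have := Finset.single_le_sum (f := fun i => ‖(toTriple μ u).2.1 i‖ ^ 2)
      (fun i _ => by positivity) (Finset.mem_univ i)
    nlinarith [sq_nonneg ‖(toTriple μ u).1‖, sq_nonneg ‖(toTriple μ u).2.2‖]
  have h2 : ∀ u : FormSpace μ, ‖(toTriple μ u).2.2‖ ≤ ‖u‖ := fun u => by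
    refine (sq_le_sq₀ (norm_nonneg _) (norm_nonneg _)).1 ?_
    rw [sq_norm_eq_toTriple]
    have := Finset.sum_nonneg (s := Finset.univ) (f := fun i => ‖(toTriple μ u).2.1 i‖ ^ 2)
      (fun i _ => by positivity)
    nlinarith [sq_nonneg ‖(toTriple μ u).1‖]
  calc ‖form μ (toTriple μ u) (toTriple μ v)‖
      ≤ ∑ i : Fin n, ‖u‖ * ‖v‖ + ‖u‖ * ‖v‖ := by
        refine (norm_form_le _ _).trans ?_
        gcongr
        exacts [h1 u _, h1 v _, h2 u, h2 v]
    _ = (n + 1) * ‖u‖ * ‖v‖ := by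
        simp only [Finset.sum_const, Finset.card_univ, Fintype.card_fin, nsmul_eq_mul]
        ring

theorem form_add_right (u v v' : Triple μ) : form μ u (v + v') = form μ u v + form μ u v' := by
  rw [← conj_form, form_add_left, map_add, conj_form, conj_form]

theorem form_smul_right (c : ℂ) (u v : Triple μ) : form μ u (c • v) = conj c * form μ u v := by
  rw [← conj_form, form_smul_left, map_mul, conj_form]

/-- The form of `-Δ + μ` as a bounded sesquilinear form on its domain. -/
def boundedForm (μ : SignedMeasure (EuclideanSpace ℝ (Fin n))) :
    FormSpace μ →L⋆[ℂ] FormSpace μ →L[ℂ] ℂ :=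
  LinearMap.mkContinuous₂ (LinearMap.mk₂'ₛₗ (starRingEnd ℂ) (RingHom.id ℂ)
    -- The arguments are swapped because `form` is linear in its first slot, where conjugate
    -- linearity is required here.
    (fun u v : FormSpace μ => form μ (toTriple μ v) (toTriple μ u))
    (fun u u' v => by simp [form_add_right]) (fun c u v => by simp [form_smul_right])
    (fun u v v' => by simp [form_add_left]) (fun c u v => by simp [form_smul_left]))
    (n + 1) fun u v => by
      refine (norm_form_toTriple_le v u).trans_eq ?_
      ring

variable (μ) in
/-- The adjoint of the inclusion of the form domain into `L²(ℝⁿ)`. -/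
def inclusionAdjoint : L2 n →L[ℂ] FormSpace μ :=
  ContinuousLinearMap.adjoint (𝕜 := ℂ) (inclusion μ)

theorem inner_inclusionAdjoint_right (v : FormSpace μ) (f : L2 n) :
    inner ℂ v (inclusionAdjoint μ f) = inner ℂ (toTriple μ v).1 f :=
  ContinuousLinearMap.adjoint_inner_right (𝕜 := ℂ)
    (inclusion μ) v f

theorem inner_inclusionAdjoint_left (v : FormSpace μ) (f : L2 n) :
    inner ℂ (inclusionAdjoint μ f) v = inner ℂ f (toTriple μ v).1 :=
  ContinuousLinearMap.adjoint_inner_left (𝕜 := ℂ)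
    (inclusion μ) v f

/-- The bounded operator on the form domain that represents the form of `-Δ + μ - E`. -/
def shiftedFormOperator (μ : SignedMeasure (EuclideanSpace ℝ (Fin n))) (E : ℝ) :
    FormSpace μ →L[ℂ] FormSpace μ :=
  InnerProductSpace.continuousLinearMapOfBilin (𝕜 := ℂ) (boundedForm μ) -
    (E : ℂ) • (inclusionAdjoint μ).comp (inclusion μ)

theorem inner_shiftedFormOperator (E : ℝ) (u v : FormSpace μ) :
    inner ℂ v (shiftedFormOperator μ E u) = form μ (toTriple μ u) (toTriple μ v) -
      E * inner ℂ (toTriple μ v).1 (toTriple μ u).1 := by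
  have h : inner ℂ v (InnerProductSpace.continuousLinearMapOfBilin (𝕜 := ℂ) (boundedForm μ) u) =
      form μ (toTriple μ u) (toTriple μ v) := by
    rw [← conj_form, ← inner_conj_symm]
    exact congrArg conj (InnerProductSpace.continuousLinearMapOfBilin_apply (𝕜 := ℂ)
      (boundedForm μ) u v)
  rw [shiftedFormOperator, sub_apply, inner_sub_right, h, smul_apply, inner_smul_right,
    ContinuousLinearMap.comp_apply, inner_inclusionAdjoint_right, inclusion_apply]

end HilbertFormDomain

/-! ### Negative eigenvalues and resolvent of the operator. -/

section Operator

variable {n : ℕ} {μ : SignedMeasure (EuclideanSpace ℝ (Fin n))} {α : ℝ}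

/-- The relation is single-valued: if x = 0 then u = 0 by uniqueness, so f is orthogonal to all test
functions and vanishes. Without this `toLinearPMap` need not have the given graph. -/
theorem graph_schrodinger (hα : (n : ℝ) - 2 < α) (hμ : CompactlySupported μ)
    (hdim : IsDimensional α μ) : (schrodinger μ).graph = operatorGraph μ := by
  refine Submodule.toLinearPMap_graph_eq _ ?_
  rintro ⟨x, f⟩ ⟨u, hu, hux, h⟩ hx
  have hu0 : u = 0 := eq_zero_of_fst_eq_zero hα hμ hdim hu (hux.trans hx)
  refine eq_zero_of_forall_mem_formDomain_inner_eq_zero (μ := μ) f fun v hv => ?_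
  rw [← h v hv, hu0]
  simpa using form_smul_left μ 0 0 v

theorem schrodinger_apply_eq_iff (hα : (n : ℝ) - 2 < α) (hμ : CompactlySupported μ)
    (hdim : IsDimensional α μ) (x f : L2 n) :
    (∃ h : x ∈ (schrodinger μ).domain, schrodinger μ ⟨x, h⟩ = f) ↔
      ∃ u ∈ formDomain μ, u.1 = x ∧ ∀ v ∈ formDomain μ, form μ u v = inner ℂ v.1 f := by
  have h1 : (x, f) ∈ (schrodinger μ).graph ↔ (x, f) ∈ operatorGraph μ := by
    rw [graph_schrodinger hα hμ hdim]
  refine Iff.trans ?_ h1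
  rw [LinearPMap.mem_graph_iff]
  constructor
  · rintro ⟨h, hf⟩
    exact ⟨⟨x, h⟩, rfl, hf⟩
  · rintro ⟨y, rfl, hf⟩
    exact ⟨y.2, hf⟩

theorem mem_eigenspace_iff (hα : (n : ℝ) - 2 < α) (hμ : CompactlySupported μ)
    (hdim : IsDimensional α μ) (z : ℂ) (x : L2 n) :
    x ∈ eigenspace (schrodinger μ) z ↔
      ∃ u ∈ formDomain μ, u.1 = x ∧ ∀ v ∈ formDomain μ, form μ u v = z * inner ℂ v.1 u.1 := by
  have h1 : x ∈ eigenspace (schrodinger μ) z ↔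
      ∃ h : x ∈ (schrodinger μ).domain, schrodinger μ ⟨x, h⟩ = z • x := by
    simp only [eigenspace, Submodule.mem_map, LinearMap.mem_ker, LinearMap.sub_apply, sub_eq_zero]
    constructor
    · rintro ⟨y, hy, rfl⟩
      exact ⟨y.2, hy⟩
    · rintro ⟨h, hx⟩
      exact ⟨⟨x, h⟩, hx, rfl⟩
  rw [h1, schrodinger_apply_eq_iff hα hμ hdim]
  refine exists_congr fun u => and_congr_right fun _ => and_congr_right fun hu => ?_
  simp only [inner_smul_right, hu]

theorem isEigenvalue_iff_exists_mem_eigenspace {F : Type*} [NormedAddCommGroup F]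
    [InnerProductSpace ℂ F] (T : F →ₗ.[ℂ] F) (z : ℂ) :
    IsEigenvalue T z ↔ ∃ x ∈ eigenspace T z, x ≠ 0 := by
  simp only [IsEigenvalue, eigenspace, Submodule.mem_map, LinearMap.mem_ker, LinearMap.sub_apply,
    sub_eq_zero]
  constructor
  · rintro ⟨u, hu, h⟩
    exact ⟨u, ⟨u, h, rfl⟩, hu⟩
  · rintro ⟨x, ⟨u, h, rfl⟩, hu⟩
    exact ⟨u, hu, h⟩

theorem exists_finset_re_form_self_nonneg (hα : (n : ℝ) - 2 < α) (hμ : CompactlySupported μ)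
    (hdim : IsDimensional α μ) :
    ∃ (s : Finset (EuclideanSpace ℝ (Fin n))) (e : EuclideanSpace ℝ (Fin n) → L2 n),
      ∀ u ∈ formDomain μ, (∀ c ∈ s, inner ℂ (e c) u.1 = 0) → 0 ≤ (form μ u u).re := by
  obtain ⟨s, e, h⟩ := exists_finset_sq_norm_le hα hμ hdim one_pos
  refine ⟨s, e, fun u hu hc => ?_⟩
  have h1 := h u hu
  rw [Finset.sum_eq_zero (s := s) fun c hcs => by
    rw [hc c hcs, norm_zero, zero_pow two_ne_zero]] at h1
  linarith [le_re_form_self u]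

/-- On an eigenvector killed by the functionals the form is both E‖x‖² with E < 0 and nonnegative,
so the functionals separate the points of the eigenspace. -/
theorem finiteDimensional_eigenspace (hα : (n : ℝ) - 2 < α) (hμ : CompactlySupported μ)
    (hdim : IsDimensional α μ) {E : ℝ} (hE : E < 0) :
    FiniteDimensional ℂ (eigenspace (schrodinger μ) (E : ℂ)) := by
  obtain ⟨s, e, h⟩ := exists_finset_re_form_self_nonneg hα hμ hdim
  let Φ : eigenspace (schrodinger μ) (E : ℂ) →ₗ[ℂ] (s → ℂ) :=
    (LinearMap.pi fun c : s => (innerSL ℂ (e c) : L2 n →ₗ[ℂ] ℂ)).comp (Submodule.subtype _)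
  refine FiniteDimensional.of_injective Φ ((injective_iff_map_eq_zero Φ).2 fun x hx => ?_)
  obtain ⟨u, hu, hux, hform⟩ := (mem_eigenspace_iff hα hμ hdim _ _).1 x.2
  have h1 := h u hu fun c hc => by
    rw [hux]
    exact congrFun hx ⟨c, hc⟩
  rw [hform u hu, inner_self_eq_norm_sq_to_K, hux] at h1
  have h2 : 0 ≤ E * ‖(x : L2 n)‖ ^ 2 := by
    rw [← Complex.ofReal_re (E * ‖(x : L2 n)‖ ^ 2)]
    push_cast
    exact h1
  have h3 : ‖(x : L2 n)‖ ^ 2 = 0 := by nlinarith [sq_nonneg ‖(x : L2 n)‖]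
  exact Subtype.ext (norm_eq_zero.1 (pow_eq_zero_iff two_ne_zero |>.1 h3))

theorem finite_negative_eigenvalues (hα : (n : ℝ) - 2 < α) (hμ : CompactlySupported μ)
    (hdim : IsDimensional α μ) :
    {E : ℝ | E < 0 ∧ IsEigenvalue (schrodinger μ) (E : ℂ)}.Finite := by
  obtain ⟨s, e, h⟩ := exists_finset_re_form_self_nonneg hα hμ hdim
  by_contra hinf
  -- One eigenvalue more than there are functionals, so that some nontrivial combination of
  -- eigenvectors is killed by all of them.
  obtain ⟨t, ht, htc⟩ := Set.Infinite.exists_subset_card_eq hinf (s.card + 1)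
  have hex : ∀ E : t, ∃ u ∈ formDomain μ, u.1 ≠ 0 ∧
      ∀ v ∈ formDomain μ, form μ u v = ((E : ℝ) : ℂ) * inner ℂ v.1 u.1 := by
    intro E
    obtain ⟨x, hx, hx0⟩ := (isEigenvalue_iff_exists_mem_eigenspace _ _).1 (ht E.2).2
    obtain ⟨u, hu, rfl, hform⟩ := (mem_eigenspace_iff hα hμ hdim _ _).1 hx
    exact ⟨u, hu, hx0, hform⟩
  choose U hU hU0 hform using hex
  have horth : ∀ E E' : t, E ≠ E' → inner ℂ (U E).1 (U E').1 = 0 := by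
    intro E E' hne
    have h1 := hform E' (U E) (hU E)
    have h2 := hform E (U E') (hU E')
    rw [← conj_form, h1, map_mul, Complex.conj_ofReal, inner_conj_symm] at h2
    have h3 : (((E' : ℝ) : ℂ) - ((E : ℝ) : ℂ)) * inner ℂ (U E').1 (U E).1 = 0 := by
      rw [sub_mul, h2, sub_self]
    rcases mul_eq_zero.1 h3 with h4 | h4
    · exact absurd (Subtype.ext (Complex.ofReal_injective (sub_eq_zero.1 h4))).symm hne
    · rw [← inner_conj_symm, h4, map_zero]
  let Φ : (t → ℂ) →ₗ[ℂ] (s → ℂ) :=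
    (LinearMap.pi fun c : s => (innerSL ℂ (e c) : L2 n →ₗ[ℂ] ℂ)).comp
      (Fintype.linearCombination ℂ fun E => (U E).1)
  have hker : LinearMap.ker Φ ≠ ⊥ := by
    refine LinearMap.ker_ne_bot_of_finrank_lt ?_
    simp [htc]
  obtain ⟨a, ha, ha0⟩ := (Submodule.ne_bot_iff _).1 hker
  set w : Triple μ := ∑ E, a E • U E with hw
  have hwmem : w ∈ formDomain μ := sum_mem fun E _ => Submodule.smul_mem _ _ (hU E)
  have hw1 : w.1 = ∑ E, a E • (U E).1 := by rw [hw, Prod.fst_sum]; rfl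
  have hpos := h w hwmem fun c hc => by
    rw [hw1]
    exact congrFun (LinearMap.mem_ker.1 ha) ⟨c, hc⟩
  have hsum : ∀ v, form μ w v = ∑ E, a E * form μ (U E) v := by
    intro v
    let L : Triple μ →ₗ[ℂ] ℂ :=
      { toFun := fun u => form μ u v
        map_add' := fun u u' => form_add_left μ u u' v
        map_smul' := fun c u => form_smul_left μ c u v }
    change L w = ∑ E, a E * L (U E)
    simp [hw]
  -- Orthogonality leaves only the diagonal terms, so the form at w is negative, against `hpos`.
  have hval : form μ w w = ∑ E : t, (((E : ℝ) * (‖a E‖ ^ 2 * ‖(U E).1‖ ^ 2) : ℝ) : ℂ) := by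
    rw [hsum]
    refine Finset.sum_congr rfl fun E _ => ?_
    rw [hform E w hwmem, hw1, sum_inner, Finset.sum_eq_single E
      (fun E' _ hne => by rw [inner_smul_left, horth E' E hne, mul_zero]) (by simp),
      inner_smul_left, inner_self_eq_norm_sq_to_K]
    have := Complex.mul_conj' (a E)
    push_cast
    rw [← this]
    simp only [Complex.coe_algebraMap]
    ring
  rw [hval, ← Complex.ofReal_sum, Complex.ofReal_re] at hpos
  obtain ⟨E, hE⟩ := Function.ne_iff.1 ha0
  refine absurd hpos (not_le.2 (Finset.sum_neg' (fun E _ => ?_) ⟨E, Finset.mem_univ E, ?_⟩))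
  · exact mul_nonpos_of_nonpos_of_nonneg (ht E.2).1.le (by positivity)
  · have h1 : 0 < ‖a E‖ := norm_pos_iff.2 hE
    have h2 : 0 < ‖(U E).1‖ := norm_pos_iff.2 (hU0 E)
    exact mul_neg_of_neg_of_pos (ht E.2).1 (by positivity)

theorem isUnit_shiftedFormOperator (hα : (n : ℝ) - 2 < α) (hμ : CompactlySupported μ)
    (hdim : IsDimensional α μ) {E : ℝ} (hE : E < 0)
    (hev : ¬ IsEigenvalue (schrodinger μ) (E : ℂ)) : IsUnit (shiftedFormOperator μ E) := by
  obtain ⟨s, e, h⟩ := exists_finset_sq_norm_le hα hμ hdim (ε := 1 / 4) (by norm_num)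
  have hc : 0 < min (1 / 2) (-E) := lt_min (by norm_num) (by linarith)
  -- Write G for ‖∇u‖² and T for ‖u‖²_{L²(|μ|)}. Twice the trace inequality with ε = 1/4 reads 2T ≤
  -- G/2 + 2∑, so G - T + 2∑ ≥ G/2 + T. The √2 supplies the factor 2, and -E‖u‖² controls the L²
  -- part of the norm.
  refine isUnit_of_injective_of_coercive_add_sum s
    (fun c => (Real.sqrt 2 : ℂ) • inclusionAdjoint μ (e c)) _ (fun u hu => ?_) hc fun u => ?_
  · by_contra hne
    refine hev ((isEigenvalue_iff_exists_mem_eigenspace _ _).2 ⟨(toTriple μ u).1,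
      (mem_eigenspace_iff hα hμ hdim _ _).2 ⟨toTriple μ u, toTriple_mem u, rfl, fun v hv => ?_⟩, fun h0 => ?_⟩)
    · obtain ⟨v, rfl⟩ := exists_toTriple_eq hv
      rw [← sub_eq_zero, ← inner_shiftedFormOperator, hu, inner_zero_right]
    · have h1 := eq_zero_of_fst_eq_zero hα hμ hdim (toTriple_mem u) h0
      exact hne ((map_eq_zero_iff _ toTriple_injective).1 h1)
  · have h1 : (inner ℂ (shiftedFormOperator μ E u) u).re =
        (form μ (toTriple μ u) (toTriple μ u)).re - E * ‖(toTriple μ u).1‖ ^ 2 := by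
      rw [← inner_conj_symm, Complex.conj_re, inner_shiftedFormOperator,
        inner_self_eq_norm_sq_to_K, Complex.sub_re, Complex.re_ofReal_mul]
      norm_cast
    have h2 : ∀ c, ‖inner ℂ ((Real.sqrt 2 : ℂ) • inclusionAdjoint μ (e c)) u‖ ^ 2 =
        2 * ‖inner ℂ (e c) (toTriple μ u).1‖ ^ 2 := by
      intro c
      rw [inner_smul_left, inner_inclusionAdjoint_left, norm_mul, mul_pow]
      simp
    simp only [h1, h2, ← Finset.mul_sum]
    have h3 := h (toTriple μ u) (toTriple_mem u)
    have h4 := le_re_form_self (toTriple μ u)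
    have h5 : ‖u‖ ^ 2 = _ := sq_norm_eq_toTriple u
    have h6 := min_le_left (1 / 2) (-E)
    have h7 := min_le_right (1 / 2) (-E)
    have h8 : 0 ≤ ∑ i, ‖(toTriple μ u).2.1 i‖ ^ 2 := by positivity
    rw [h5]
    nlinarith [sq_nonneg ‖(toTriple μ u).1‖, sq_nonneg ‖(toTriple μ u).2.2‖]

theorem mem_resolventSet_of_not_isEigenvalue (hα : (n : ℝ) - 2 < α) (hμ : CompactlySupported μ)
    (hdim : IsDimensional α μ) {E : ℝ} (hE : E < 0)
    (hev : ¬ IsEigenvalue (schrodinger μ) (E : ℂ)) : (E : ℂ) ∈ resolventSet (schrodinger μ) := by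
  obtain ⟨A, hA⟩ := isUnit_shiftedFormOperator hα hμ hdim hE hev
  set S : FormSpace μ →L[ℂ] FormSpace μ := ↑A⁻¹ with hS
  have hAS : ∀ u, shiftedFormOperator μ E (S u) = u := fun u => by
    rw [← mul_apply_eq_comp, ← hA, hS, A.mul_inv]; rfl
  have hSA : ∀ u, S (shiftedFormOperator μ E u) = u := fun u => by
    rw [← mul_apply_eq_comp, ← hA, hS, A.inv_mul]; rfl
  -- The resolvent is J S J*, where J is the inclusion and S inverts the shifted form operator.
  refine ⟨(inclusion μ).comp (S.comp (inclusionAdjoint μ)), fun f => ?_, fun u => ?_⟩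
  · set u := S (inclusionAdjoint μ f) with hu
    have h1 : ∀ v ∈ formDomain μ, form μ (toTriple μ u) v =
        inner ℂ v.1 (f + (E : ℂ) • (toTriple μ u).1) := by
      intro v hv
      obtain ⟨v, rfl⟩ := exists_toTriple_eq hv
      have h2 := inner_shiftedFormOperator E u v
      rw [hu, hAS, inner_inclusionAdjoint_right, ← hu] at h2
      rw [inner_add_right, inner_smul_right, h2, sub_add_cancel]
    obtain ⟨h, hf⟩ := (schrodinger_apply_eq_iff hα hμ hdim (toTriple μ u).1 _).2
      ⟨toTriple μ u, toTriple_mem u, rfl, h1⟩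
    exact ⟨h, (congrArg (· - (E : ℂ) • (toTriple μ u).1) hf).trans (add_sub_cancel_right _ _)⟩
  · obtain ⟨w, hw, hwu, hform⟩ := (schrodinger_apply_eq_iff hα hμ hdim u _).1 ⟨u.2, rfl⟩
    obtain ⟨w, rfl⟩ := exists_toTriple_eq hw
    have h1 : inclusionAdjoint μ (schrodinger μ u - (E : ℂ) • (u : L2 n)) =
        shiftedFormOperator μ E w := by
      refine ext_inner_left ℂ fun v => ?_
      rw [inner_shiftedFormOperator, hform _ (toTriple_mem v), inner_inclusionAdjoint_right, inner_sub_right,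
        inner_smul_right, hwu]
    rw [ContinuousLinearMap.comp_apply, ContinuousLinearMap.comp_apply, h1, hSA, inclusion_apply,
      hwu]

end Operator

end MeasureSchrodinger

end

theorem proposition2p2 (n : ℕ) (hn : 3 ≤ n) (α : ℝ) (hα : (n : ℝ) - 2 < α)
    (μ : MeasureTheory.SignedMeasure (EuclideanSpace ℝ (Fin n)))
    (hμ : MeasureSchrodinger.CompactlySupported μ)
    (hdim : MeasureSchrodinger.IsDimensional α μ) :
    {E : ℝ | E < 0 ∧
      MeasureSchrodinger.IsEigenvalue (MeasureSchrodinger.schrodinger μ) (E : ℂ)}.Finite ∧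
    (∀ E : ℝ, E < 0 → FiniteDimensional ℂ
      (MeasureSchrodinger.eigenspace (MeasureSchrodinger.schrodinger μ) (E : ℂ))) ∧
    (∀ E : ℝ, E < 0 →
      (E : ℂ) ∈ MeasureSchrodinger.spectrum (MeasureSchrodinger.schrodinger μ) →
      MeasureSchrodinger.IsEigenvalue (MeasureSchrodinger.schrodinger μ) (E : ℂ)) :=
  ⟨MeasureSchrodinger.finite_negative_eigenvalues hα hμ hdim,
    fun _ hE => MeasureSchrodinger.finiteDimensional_eigenspace hα hμ hdim hE,
    fun _ hE hs => by_contra fun hev =>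
      hs (MeasureSchrodinger.mem_resolventSet_of_not_isEigenvalue hα hμ hdim hE hev)⟩
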